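/- Let $\Box$ be the cube category with both connections: its objects are the posets $[1]^n=\{0\le 1\}^n$, $n\ge 0$, and its morphisms are the maps generated under composition by the faces $\partial_{i,\varepsilon}\colon[1]^{n-1}\to[1]^n$ (insert the coordinate $\varepsilon\in\{0,1\}$ in position $i$), the degeneracies $\sigma_i\colon[1]^n\to[1]^{n-1}$ (omit the $i$-th coordinate) and the connections $\gamma_{i,0},\gamma_{i,1}\colon[1]^n\to[1]^{n-1}$ (replace the coordinates $x_i,x_{i+1}$ by $\max\{x_i,x_{i+1}\}$, respectively $\min\{x_i,x_{i+1}\}$). A cubical set is a functor $X\colon\Box^{\mathrm{op}}\to\mathsf{Set}$; $X_n$ denotes its value at $[1]^n$, and morphisms of $\Box$ act on cubes from the right. It is a Kan complex if for all $n\ge1$, $1\le i\le n$ and $\varepsilon\in\{0,1\}$, every map $\sqcap^n_{i,\varepsilon}\to X$ extends along the inclusion $\sqcap^n_{i,\varepsilon}\hookrightarrow\Box^n$, where $\Box^n$ is the functor represented by $[1]^n$ and $\sqcap^n_{i,\varepsilon}$ is the union of the images of all faces $\partial_{j,\eta}$ with $(j,\eta)\ne(i,\varepsilon)$. For a pointed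 Kan complex $(X,x)$, $x\in X_0$, let $\Omega(X,x)$ be the cubical set whose $n$-cubes are the cubes $u\in X_{n+1}$ with $u\partial_{1,0}$ and $u\partial_{1,1}$ both degenerate at $x$, where $f\colon[1]^m\to[1]^n$ acts through $\mathrm{id}_{[1]^1}\times f$, pointed by $x\sigma_1$; it is again a Kan complex. Put $\Omega^0(X,x)=(X,x)$ and $\Omega^{n+1}(X,x)=\Omega(\Omega^n(X,x))$, and let $\pi_n(X,x)$ be the set of connected components of $\Omega^n(X,x)$, i.e. the quotient of its set of $0$-cubes by the equivalence relation generated by its $1$-cubes. The set $\pi_1(X,x)$ is a group with neutral element $[x\sigma_1]$ and multiplication $[f][g]=[h]$ whenever there is $S\in X_2$ with $S\partial_{1,0}=f$, $S\partial_{2,1}=g$, $S\partial_{1,1}=x\sigma_1$ and $S\partial_{2,0}=h$; for $n\ge1$ the group structure on $\pi_n(X,x)$ is that of $\pi_1(\Omega^{n-1}(X,x))$. **Corollary.** For every pointed Kan complex $(X,x)$ and every $n\ge2$, the group $\pi_n(X,x)$ is abelian. -/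

import Mathlib

open CategoryTheory Opposite

universe u

namespace Cubical

/-! ### The cube category -/

/-- The poset `[1]^n`, with the componentwise order (`false ≤ true`, i.e. `0 ≤ 1`). -/
abbrev Pow (n : ℕ) : Type := Fin n → Bool

/-- The face map inserting the coordinate `ε` in position `i` (positions are numbered from `0`). -/
def faceMap {n : ℕ} (i : Fin (n + 1)) (ε : Bool) : Pow n →o Pow (n + 1) where
  toFun x := i.insertNth ε x
  monotone' x y h := by
    intro j
    induction j using Fin.succAboveCases i with
    | x => simp
    | p j => simpa using h j

/-- The degeneracy map omitting the coordinate in position `i`. -/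
def degenMap {n : ℕ} (i : Fin (n + 1)) : Pow (n + 1) →o Pow n where
  toFun x := i.removeNth x
  monotone' _ _ h := fun j => h (i.succAbove j)

/-- `max` for `ε = 0` and `min` for `ε = 1`. -/
def connOp (ε : Bool) (a b : Bool) : Bool := if ε then a ⊓ b else a ⊔ b

/-- The connection replacing the coordinates in the positions `i` and `i + 1` by their maximum
(`ε = 0`, negative connection) or their minimum (`ε = 1`, positive connection). -/
def connMap {n : ℕ} (i : Fin n) (ε : Bool) : Pow (n + 1) →o Pow n where
  toFun x j :=
    if j < i then x j.castSucc
    else if j = i then connOp ε (x i.castSucc) (x i.succ)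
    else x j.succ
  monotone' x y h := by
    intro j
    dsimp only
    split_ifs
    · exact h _
    · cases ε
      · exact sup_le_sup (h _) (h _)
      · exact inf_le_inf (h _) (h _)
    · exact h _

/-- The monotone maps `[1]^m → [1]^n` generated under composition by the faces, the degeneracies
and the two kinds of connections. -/
inductive IsBoxMap : ∀ {m n : ℕ}, (Pow m →o Pow n) → Prop
  | id (n : ℕ) : IsBoxMap (OrderHom.id : Pow n →o Pow n)
  | face {n : ℕ} (i : Fin (n + 1)) (ε : Bool) : IsBoxMap (faceMap i ε)
  | degen {n : ℕ} (i : Fin (n + 1)) : IsBoxMap (degenMap i)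
  | conn {n : ℕ} (i : Fin n) (ε : Bool) : IsBoxMap (connMap i ε)
  | comp {l m n : ℕ} {f : Pow l →o Pow m} {g : Pow m →o Pow n} :
      IsBoxMap f → IsBoxMap g → IsBoxMap (g.comp f)

/-- The objects of the cube category: `⟨n⟩` stands for `[1]^n`. -/
structure Box : Type where
  dim : ℕ

instance : Category Box where
  Hom m n := {f : Pow m.dim →o Pow n.dim // IsBoxMap f}
  id m := ⟨OrderHom.id, IsBoxMap.id _⟩
  comp f g := ⟨g.1.comp f.1, IsBoxMap.comp f.2 g.2⟩

theorem Box.hom_ext {m n : Box} {f g : m ⟶ n} (h : ∀ x : Pow m.dim, f.1 x = g.1 x) : f = g :=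
  Subtype.ext (OrderHom.ext _ _ (funext h))

theorem Box.comp_apply {l m n : Box} (f : l ⟶ m) (g : m ⟶ n) (x : Pow l.dim) :
    (f ≫ g).1 x = g.1 (f.1 x) := rfl

theorem Box.id_apply {m : Box} (x : Pow m.dim) : (𝟙 m : m ⟶ m).1 x = x := rfl

/-- The face `[1]^n ⟶ [1]^(n+1)` as a morphism of the cube category. -/
def face {n : ℕ} (i : Fin (n + 1)) (ε : Bool) : (⟨n⟩ : Box) ⟶ ⟨n + 1⟩ :=
  ⟨faceMap i ε, IsBoxMap.face i ε⟩

/-- The degeneracy `[1]^(n+1) ⟶ [1]^n` as a morphism of the cube category. -/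
def degen {n : ℕ} (i : Fin (n + 1)) : (⟨n + 1⟩ : Box) ⟶ ⟨n⟩ :=
  ⟨degenMap i, IsBoxMap.degen i⟩

theorem face_apply {n : ℕ} (i : Fin (n + 1)) (ε : Bool) (x : Pow n) :
    (face i ε).1 x = i.insertNth ε x := rfl

theorem degen_apply {n : ℕ} (i : Fin (n + 1)) (x : Pow (n + 1)) :
    (degen i).1 x = i.removeNth x := rfl

/-- The map `[1]^n ⟶ [1]^0`. -/
def toPoint : ∀ n : ℕ, (⟨n⟩ : Box) ⟶ ⟨0⟩
  | 0 => 𝟙 _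
  | n + 1 => degen 0 ≫ toPoint n

theorem toPoint_unique {m : Box} (f g : m ⟶ ⟨0⟩) : f = g :=
  Box.hom_ext fun _ => funext fun j => j.elim0

/-- The monotone map `id × f : [1]^(1+m) → [1]^(1+n)`. -/
def consMap {m n : ℕ} (f : Pow m →o Pow n) : Pow (m + 1) →o Pow (n + 1) where
  toFun x := Fin.cons (x 0) (f (Fin.tail x))
  monotone' x y h := by
    intro j
    refine Fin.cases ?_ (fun j => ?_) j
    · exact h 0
    · exact f.monotone (fun k => h k.succ) j

theorem consMap_zero {m n : ℕ} (f : Pow m →o Pow n) (x : Pow (m + 1)) :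
    consMap f x 0 = x 0 := rfl

theorem consMap_succ {m n : ℕ} (f : Pow m →o Pow n) (x : Pow (m + 1)) (j : Fin n) :
    consMap f x j.succ = f (Fin.tail x) j := rfl

theorem connMap_apply {n : ℕ} (i : Fin n) (ε : Bool) (x : Pow (n + 1)) (j : Fin n) :
    connMap i ε x j = if j < i then x j.castSucc
      else if j = i then connOp ε (x i.castSucc) (x i.succ) else x j.succ := rfl

theorem consMap_faceMap {n : ℕ} (i : Fin (n + 1)) (ε : Bool) (x : Pow (n + 1)) :
    consMap (faceMap i ε) x = faceMap i.succ ε x := by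
  refine Fin.eq_insertNth_iff.2 ⟨Fin.insertNth_apply_same (α := fun _ => Bool) i ε (Fin.tail x), funext fun j => ?_⟩
  refine Fin.cases ?_ (fun j => ?_) j
  · rw [Fin.removeNth_apply, Fin.succ_succAbove_zero]
    rfl
  · rw [Fin.removeNth_apply, Fin.succ_succAbove_succ]
    exact Fin.insertNth_apply_succAbove (α := fun _ => Bool) i ε (Fin.tail x) j

theorem IsBoxMap.consMap {m n : ℕ} {f : Pow m →o Pow n} (hf : IsBoxMap f) :
    IsBoxMap (consMap f) := by
  induction hf with
  | id n =>
    convert IsBoxMap.id (n + 1) using 1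
    ext x j
    refine Fin.cases ?_ (fun j => ?_) j <;> rfl
  | face i ε =>
    convert IsBoxMap.face i.succ ε using 1
    exact OrderHom.ext _ _ (funext fun x => consMap_faceMap i ε x)
  | degen i =>
    convert IsBoxMap.degen i.succ using 1
    ext x j
    refine Fin.cases ?_ (fun j => ?_) j
    · change x 0 = x (i.succ.succAbove 0)
      rw [Fin.succ_succAbove_zero]
    · change x (i.succAbove j).succ = x (i.succ.succAbove j.succ)
      rw [Fin.succ_succAbove_succ]
  | conn i ε =>
    convert IsBoxMap.conn i.succ ε using 1
    refine OrderHom.ext _ _ (funext fun x => funext fun j => ?_)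
    refine Fin.cases ?_ (fun j => ?_) j
    · rw [consMap_zero, connMap_apply, if_pos (Fin.succ_pos i), Fin.castSucc_zero]
    · rw [consMap_succ, connMap_apply, connMap_apply]
      simp only [Fin.succ_lt_succ_iff, Fin.succ_inj]
      rfl
  | @comp l m n f g _ _ hf hg =>
    have h : Cubical.consMap (g.comp f) = (Cubical.consMap g).comp (Cubical.consMap f) := rfl
    rw [h]
    exact IsBoxMap.comp hf hg

/-- The functor `[1]^1 ⊗ -` of the cube category, `[1]^n ↦ [1]^(1+n)`. -/
def shift : Box ⥤ Box where
  obj m := ⟨m.dim + 1⟩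
  map f := ⟨consMap f.1, f.2.consMap⟩
  map_id m := Box.hom_ext fun x => by
    funext j
    refine Fin.cases ?_ (fun j => ?_) j <;> rfl
  map_comp f g := rfl

/-- The morphism `id ⊗ f : [1]^(1+m) ⟶ [1]^(1+n)`. -/
abbrev shiftHom {m n : ℕ} (f : (⟨m⟩ : Box) ⟶ ⟨n⟩) : (⟨m + 1⟩ : Box) ⟶ ⟨n + 1⟩ := shift.map f

theorem face_zero_shift {m n : ℕ} (f : (⟨m⟩ : Box) ⟶ ⟨n⟩) (ε : Bool) :
    face 0 ε ≫ shiftHom f = f ≫ face 0 ε := by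
  refine Box.hom_ext fun x => ?_
  change Fin.cons ((Fin.insertNth 0 ε x : Pow (m + 1)) 0)
    (f.1 (Fin.tail (Fin.insertNth 0 ε x : Pow (m + 1)))) = (Fin.insertNth 0 ε (f.1 x : Pow n) : Pow (n + 1))
  rw [Fin.insertNth_zero', Fin.insertNth_zero', Fin.cons_zero, Fin.tail_cons]

theorem face_shift {n : ℕ} (i : Fin (n + 1)) (ε : Bool) :
    shiftHom (face i ε) = face i.succ ε :=
  Box.hom_ext fun x => consMap_faceMap i ε x

/-! ### Cubical sets and Kan complexes -/

/-- Cubical sets: presheaves on the cube category. -/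
abbrev CSet : Type (u + 1) := Boxᵒᵖ ⥤ Type u

/-- The set of `n`-cubes. -/
abbrev CSet.Cubes (X : CSet.{u}) (n : ℕ) : Type u := X.obj (op ⟨n⟩)

/-- The action `c f` of a morphism `f : [1]^m ⟶ [1]^n` on an `n`-cube `c`. -/
def CSet.act (X : CSet.{u}) {m n : ℕ} (c : X.Cubes n) (f : (⟨m⟩ : Box) ⟶ ⟨n⟩) : X.Cubes m :=
  X.map f.op c

/-- The combinatorial `n`-cube, that is the functor represented by `[1]^n`. -/
abbrev cube (n : ℕ) : CSet.{u} := uliftYoneda.{u}.obj (⟨n⟩ : Box)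

/-- The open box in the `(n+1)`-cube: the union of the images of all faces but the face
`(i, ε)`. -/
def openBox (n : ℕ) (i : Fin (n + 1)) (ε : Bool) : Subfunctor (cube.{u} (n + 1)) where
  obj k := {f | ∃ (j : Fin (n + 1)) (η : Bool), (j, η) ≠ (i, ε) ∧
    ∃ g : k.unop ⟶ (⟨n⟩ : Box), g ≫ face j η = f.down}
  map := by
    rintro k l h f ⟨j, η, hj, g, hg⟩
    exact ⟨j, η, hj, h.unop ≫ g, by rw [Category.assoc, hg]; rfl⟩

/-- Kan complexes: every open box in `X` has a filler. -/
def CSet.IsKan (X : CSet.{u}) : Prop :=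
  ∀ (n : ℕ) (i : Fin (n + 1)) (ε : Bool) (s : (openBox.{u} n i ε).toFunctor ⟶ X),
    ∃ t : cube.{u} (n + 1) ⟶ X, (openBox.{u} n i ε).ι ≫ t = s

/-! ### Connected components -/

/-- Two vertices are joined by a `1`-cube. -/
def CSet.Joined (X : CSet.{u}) (a b : X.Cubes 0) : Prop :=
  ∃ e : X.Cubes 1, X.act e (face 0 false) = a ∧ X.act e (face 0 true) = b

/-- The set of connected components: the quotient of the set of vertices by the equivalence
relation generated by the `1`-cubes. -/
def CSet.Pi0 (X : CSet.{u}) : Type u := Quot X.Joined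

/-! ### Pointed cubical sets and loop spaces -/

/-- A cubical set with a chosen vertex. -/
structure PtdCSet : Type (u + 1) where
  X : CSet.{u}
  pt : X.Cubes 0

/-- The `n`-cube that is degenerate at the base point. -/
def PtdCSet.base (P : PtdCSet.{u}) (n : ℕ) : P.X.Cubes n := P.X.act P.pt (toPoint n)

section Act

variable {X : CSet.{u}}

theorem act_comp {l m n : ℕ} (f : (⟨l⟩ : Box) ⟶ ⟨m⟩) (g : (⟨m⟩ : Box) ⟶ ⟨n⟩) (c : X.Cubes n) :
    X.act c (f ≫ g) = X.act (X.act c g) f := by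
  simp [CSet.act]

theorem act_id {n : ℕ} (c : X.Cubes n) : X.act c (𝟙 _) = c := by
  simp [CSet.act]

theorem base_act (P : PtdCSet.{u}) {m n : ℕ} (f : (⟨m⟩ : Box) ⟶ ⟨n⟩) :
    P.X.act (P.base n) f = P.base m := by
  rw [PtdCSet.base, ← act_comp, toPoint_unique (f ≫ toPoint n) (toPoint m), ← PtdCSet.base]

end Act

/-- The internal hom `hom(□¹, X)` out of the `1`-cube for the geometric product: its `n`-cubes are
the maps `□¹ ⊗ □ⁿ = □ⁿ⁺¹ → X`, and `f` acts on them through `□¹ ⊗ f`. -/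
def pathObject (X : CSet.{u}) : CSet.{u} := shift.op ⋙ X

/-- Both faces of an `(n+1)`-cube in the first direction are degenerate at the base point. -/
def PtdCSet.IsLoop (P : PtdCSet.{u}) {n : ℕ} (c : P.X.Cubes (n + 1)) : Prop :=
  ∀ ε : Bool, P.X.act c (face 0 ε) = P.base n

theorem PtdCSet.IsLoop.act {P : PtdCSet.{u}} {m n : ℕ} {c : P.X.Cubes (n + 1)} (hc : P.IsLoop c)
    (f : (⟨m⟩ : Box) ⟶ ⟨n⟩) : P.IsLoop (P.X.act c (shiftHom f)) := fun ε => by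
  rw [← act_comp, face_zero_shift, act_comp, hc ε, base_act]

/-- The loops, as a cubical subset of `hom(□¹, X)`. -/
def loopSub (P : PtdCSet.{u}) : Subfunctor (pathObject P.X) where
  obj k := {c | P.IsLoop (n := k.unop.dim) c}
  map h _ hc := PtdCSet.IsLoop.act hc h.unop

/-- The loop space of a pointed cubical set, pointed by the degenerate `1`-cube. -/
def loop (P : PtdCSet.{u}) : PtdCSet.{u} where
  X := (loopSub P).toFunctor
  pt := ⟨P.base 1, fun ε => base_act P (face 0 ε)⟩

/-- The iterated loop spaces. -/
def iterLoop (P : PtdCSet.{u}) : ℕ → PtdCSet.{u}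
  | 0 => P
  | n + 1 => loop (iterLoop P n)


section Fill

theorem succAbove_comm {n : ℕ} {a b : Fin (n + 1)} (h : b ≤ a) (j : Fin n) :
    a.succ.succAbove (b.succAbove j) = b.castSucc.succAbove (a.succAbove j) := by
  have h' : (b : ℕ) ≤ a := h
  apply Fin.ext
  simp only [Fin.succAbove, Fin.lt_def, Fin.val_castSucc, Fin.val_succ]
  split_ifs <;> simp_all <;> omega

theorem face_comm {n : ℕ} {a b : Fin (n + 1)} (h : b ≤ a) (η θ : Bool) :
    face a η ≫ face b.castSucc θ = face b θ ≫ face a.succ η := by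
  have h1 : b.castSucc.succAbove a = a.succ := Fin.succAbove_of_le_castSucc _ _ (by simpa using h)
  have h2 : a.succ.succAbove b = b.castSucc := Fin.succAbove_of_castSucc_lt _ _ (by
    simpa [Fin.lt_def, Nat.lt_succ_iff] using h)
  refine Box.hom_ext fun x => ?_
  change (Fin.insertNth b.castSucc θ (Fin.insertNth a η x : Pow (n + 1)) : Pow (n + 2)) =
    (Fin.insertNth a.succ η (Fin.insertNth b θ x : Pow (n + 1)) : Pow (n + 2))
  refine Fin.eq_insertNth_iff.2 ⟨?_, Fin.eq_insertNth_iff.2 ⟨?_, funext fun j => ?_⟩⟩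
  · rw [← h1, Fin.insertNth_apply_succAbove, Fin.insertNth_apply_same]
  · rw [Fin.removeNth_apply, h2, Fin.insertNth_apply_same]
  · rw [Fin.removeNth_apply, Fin.removeNth_apply, succAbove_comm h,
      Fin.insertNth_apply_succAbove, Fin.insertNth_apply_succAbove]

theorem face_degen {n : ℕ} (i : Fin (n + 1)) (ε : Bool) : face i ε ≫ degen i = 𝟙 _ :=
  Box.hom_ext fun x => Fin.removeNth_insertNth (α := fun _ => Bool) i ε x

/-- A morphism whose `i`-th coordinate is constantly `ε` factors through the face. -/
theorem degen_face {k n : ℕ} (f : (⟨k⟩ : Box) ⟶ ⟨n + 1⟩) (i : Fin (n + 1)) (ε : Bool)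
    (h : ∀ x : Pow k, f.1 x i = ε) : (f ≫ degen i) ≫ face i ε = f :=
  Box.hom_ext fun x => (Fin.eq_insertNth_iff.2 ⟨h x, rfl⟩).symm

theorem comp_face_same {k n : ℕ} (g : (⟨k⟩ : Box) ⟶ ⟨n⟩) (i : Fin (n + 1)) (ε : Bool) (x : Pow k) :
    (g ≫ face i ε).1 x i = ε :=
  Fin.insertNth_apply_same (α := fun _ => Bool) i ε _

theorem comp_face_succAbove {k n : ℕ} (g : (⟨k⟩ : Box) ⟶ ⟨n⟩) (i : Fin (n + 1)) (ε : Bool)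
    (x : Pow k) (j : Fin n) : (g ≫ face i ε).1 x (i.succAbove j) = g.1 x j :=
  Fin.insertNth_apply_succAbove (α := fun _ => Bool) i ε _ _

theorem face_mono {k n : ℕ} {g g' : (⟨k⟩ : Box) ⟶ ⟨n⟩} {i : Fin (n + 1)} {ε : Bool}
    (h : g ≫ face i ε = g' ≫ face i ε) : g = g' := by
  have := congrArg (· ≫ degen i) h
  simpa [Category.assoc, face_degen] using this

/-- Two distinct faces in distinct directions intersect in a common face. -/
theorem face_inter {k n : ℕ} {a b : Fin (n + 1)} (h : b ≤ a) {η θ : Bool}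
    {v w : (⟨k⟩ : Box) ⟶ ⟨n + 1⟩} (e : v ≫ face a.succ η = w ≫ face b.castSucc θ) :
    ∃ z : (⟨k⟩ : Box) ⟶ ⟨n⟩, v = z ≫ face b θ ∧ w = z ≫ face a η := by
  have h1 : b.castSucc.succAbove a = a.succ := Fin.succAbove_of_le_castSucc _ _ (by simpa using h)
  have hw : (w ≫ degen a) ≫ face a η = w := by
    refine degen_face w a η fun x => ?_
    rw [← comp_face_succAbove w b.castSucc θ x a, ← e, h1, comp_face_same]
  refine ⟨w ≫ degen a, face_mono (i := a.succ) (ε := η) ?_, hw.symm⟩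
  rw [Category.assoc, ← face_comm h, ← Category.assoc, hw, e]

variable {X : CSet.{u}}

theorem compat_aux {n : ℕ} {i : Fin (n + 2)} {ε : Bool}
    {c : Fin (n + 2) → Bool → X.Cubes (n + 1)}
    (hc : ∀ (a b : Fin (n + 1)) (η θ : Bool), b ≤ a → (a.succ, η) ≠ (i, ε) →
      (b.castSucc, θ) ≠ (i, ε) → X.act (c a.succ η) (face b θ) = X.act (c b.castSucc θ) (face a η))
    {k : ℕ} {p q : Fin (n + 2)} {η θ : Bool} (hp : (p, η) ≠ (i, ε)) (hq : (q, θ) ≠ (i, ε))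
    {v w : (⟨k⟩ : Box) ⟶ ⟨n + 1⟩} (e : v ≫ face p η = w ≫ face q θ) :
    X.act (c p η) v = X.act (c q θ) w := by
  have main : ∀ {p q : Fin (n + 2)} {η θ : Bool}, (p, η) ≠ (i, ε) → (q, θ) ≠ (i, ε) → q < p →
      ∀ {v w : (⟨k⟩ : Box) ⟶ ⟨n + 1⟩}, v ≫ face p η = w ≫ face q θ →
      X.act (c p η) v = X.act (c q θ) w := by
    intro p q η θ hp hq hlt v w e
    obtain ⟨a, rfl⟩ := Fin.exists_succ_eq.2 (Fin.ne_zero_of_lt hlt)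
    obtain ⟨b, rfl⟩ := Fin.exists_castSucc_eq.2 (Fin.ne_last_of_lt hlt)
    have hba : b ≤ a := by simpa [Fin.lt_def, Nat.lt_succ_iff] using hlt
    obtain ⟨z, rfl, rfl⟩ := face_inter hba e
    rw [act_comp, act_comp, hc a b η θ hba hp hq]
  rcases lt_trichotomy p q with h | h | h
  · exact (main hq hp h e.symm).symm
  · subst h
    have hη : η = θ := by
      have h1 := comp_face_same v p η (fun _ => false)
      rw [e, comp_face_same] at h1
      exact h1.symm
    subst hη
    rw [face_mono e]
  · exact main hp hq h e

/-- An open box given by compatible faces has a filler. -/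
theorem CSet.IsKan.fill (hX : X.IsKan) {n : ℕ} (i : Fin (n + 2)) (ε : Bool)
    (c : Fin (n + 2) → Bool → X.Cubes (n + 1))
    (hc : ∀ (a b : Fin (n + 1)) (η θ : Bool), b ≤ a → (a.succ, η) ≠ (i, ε) →
      (b.castSucc, θ) ≠ (i, ε) →
      X.act (c a.succ η) (face b θ) = X.act (c b.castSucc θ) (face a η)) :
    ∃ t : X.Cubes (n + 2), ∀ (j : Fin (n + 2)) (η : Bool), (j, η) ≠ (i, ε) →
      X.act t (face j η) = c j η := by
  classical
  let val : ∀ k : Boxᵒᵖ, (openBox.{u} (n + 1) i ε).toFunctor.obj k → X.obj k := fun k f =>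
    X.act (m := k.unop.dim) (c f.2.choose f.2.choose_spec.choose)
      f.2.choose_spec.choose_spec.2.choose
  have hval : ∀ (k : ℕ) (f : (openBox.{u} (n + 1) i ε).toFunctor.obj (op ⟨k⟩)) (j : Fin (n + 2))
      (η : Bool), (j, η) ≠ (i, ε) → ∀ g : (⟨k⟩ : Box) ⟶ ⟨n + 1⟩, g ≫ face j η = f.1.down →
      val _ f = X.act (c j η) g := by
    intro k f j η hj g hg
    exact compat_aux hc f.2.choose_spec.choose_spec.1 hj
      (f.2.choose_spec.choose_spec.2.choose_spec.trans hg.symm)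
  let s : (openBox.{u} (n + 1) i ε).toFunctor ⟶ X :=
    { app := fun k => TypeCat.ofHom (val k)
      naturality := by
        rintro ⟨⟨k⟩⟩ ⟨⟨l⟩⟩ h
        ext f
        obtain ⟨j, η, hj, g, hg⟩ := f.2
        have h1 := hval k f j η hj g hg
        have h2 := hval l ((openBox.{u} (n + 1) i ε).toFunctor.map h f) j η hj (h.unop ≫ g)
          (by rw [Category.assoc, hg]; rfl)
        change val _ _ = X.map h (val _ f)
        rw [h1, h2, act_comp]
        rfl }
  obtain ⟨t, ht⟩ := hX (n + 1) i ε s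
  refine ⟨uliftYonedaEquiv t, fun j η hj => ?_⟩
  have hmem : (ULift.up (face j η) : (cube.{u} (n + 2)).obj (op ⟨n + 1⟩)) ∈
      (openBox.{u} (n + 1) i ε).obj (op ⟨n + 1⟩) := ⟨j, η, hj, 𝟙 _, Category.id_comp _⟩
  have h1 := hval (n + 1) ⟨_, hmem⟩ j η hj (𝟙 _) (Category.id_comp _)
  rw [act_id] at h1
  rw [← h1]
  change X.map (face j η).op (uliftYonedaEquiv t) = s.app _ ⟨_, hmem⟩
  rw [← ht, uliftYonedaEquiv_naturality]
  simp [uliftYonedaEquiv]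
  rfl

end Fill


section LoopKan

/-- The faces in an open box. -/
def boxFace {n : ℕ} {i : Fin (n + 1)} {ε : Bool} (j : Fin (n + 1)) (η : Bool)
    (h : (j, η) ≠ (i, ε)) : (openBox.{u} n i ε).toFunctor.obj (op ⟨n⟩) :=
  ⟨ULift.up (face j η), j, η, h, 𝟙 _, Category.id_comp _⟩

theorem boxFace_map {n : ℕ} {i : Fin (n + 1)} {ε : Bool} {Y : CSet.{u}}
    (s : (openBox.{u} n i ε).toFunctor ⟶ Y) {j : Fin (n + 1)} {η : Bool} (h : (j, η) ≠ (i, ε))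
    {k : ℕ} (g : (⟨k⟩ : Box) ⟶ ⟨n⟩)
    (f : (openBox.{u} n i ε).toFunctor.obj (op ⟨k⟩)) (hf : g ≫ face j η = f.1.down) :
    s.app _ f = Y.act (s.app _ (boxFace j η h)) g := by
  have : f = (openBox.{u} n i ε).toFunctor.map g.op (boxFace j η h) :=
    Subtype.ext (ULift.ext _ _ hf.symm)
  rw [this]
  exact NatTrans.naturality_apply s g.op (boxFace j η h)

theorem exists_extension {n : ℕ} {i : Fin (n + 1)} {ε : Bool} {Y : CSet.{u}}
    (s : (openBox.{u} n i ε).toFunctor ⟶ Y) (t : Y.Cubes (n + 1))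
    (ht : ∀ (j : Fin (n + 1)) (η : Bool) (h : (j, η) ≠ (i, ε)),
      Y.act t (face j η) = s.app _ (boxFace j η h)) :
    ∃ t' : cube.{u} (n + 1) ⟶ Y, (openBox.{u} n i ε).ι ≫ t' = s := by
  refine ⟨uliftYonedaEquiv.symm t, ?_⟩
  ext ⟨⟨k⟩⟩ f
  obtain ⟨j, η, hj, g, hg⟩ := f.2
  refine Eq.trans ?_ (boxFace_map s hj g f hg).symm
  rw [← ht, ← act_comp, hg]
  rfl

theorem loop_act_val {P : PtdCSet.{u}} {m n : ℕ} (c : (loop P).X.Cubes n)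
    (f : (⟨m⟩ : Box) ⟶ ⟨n⟩) : ((loop P).X.act c f).1 = P.X.act (n := n + 1) c.1 (shiftHom f) := rfl

theorem loop_isKan {P : PtdCSet.{u}} (hP : P.X.IsKan) : (loop P).X.IsKan := by
  classical
  intro n i ε s
  let c : Fin (n + 2) → Bool → P.X.Cubes (n + 1) := fun j η =>
    Fin.cases (motive := fun _ => P.X.Cubes (n + 1)) (P.base (n + 1))
      (fun j => if h : (j, η) ≠ (i, ε) then (s.app _ (boxFace j η h)).1 else P.base (n + 1)) j
  have c_zero : ∀ η, c 0 η = P.base (n + 1) := fun η => rfl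
  have c_succ : ∀ (j : Fin (n + 1)) (η : Bool) (h : (j, η) ≠ (i, ε)),
      c j.succ η = (s.app _ (boxFace j η h)).1 := fun j η h => dif_pos h
  have hsucc : ∀ {j : Fin (n + 1)} {η : Bool}, (j.succ, η) ≠ (i.succ, ε) → (j, η) ≠ (i, ε) := by
    intro j η h h'
    simp_all
  obtain ⟨t, ht⟩ := hP.fill i.succ ε c (by
    intro a b η θ hba ha hb
    have ha' := hsucc ha
    rw [c_succ a η ha']
    refine Fin.cases ?_ (fun b => ?_) b hba hb
    · intro _ _
      rw [Fin.castSucc_zero, c_zero, base_act]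
      exact (s.app _ (boxFace a η ha')).2 θ
    · intro hba hb
      obtain ⟨a, rfl⟩ := Fin.exists_succ_eq.2 (Fin.ne_zero_of_lt (lt_of_lt_of_le b.succ_pos hba))
      rcases n with _ | n
      · exact a.elim0
      have hba' : b ≤ a := by simpa using hba
      have hb' : (b.castSucc, θ) ≠ (i, ε) := hsucc hb
      rw [← Fin.succ_castSucc, c_succ _ θ hb', ← face_shift, ← face_shift]
      have h1 := boxFace_map s ha' (face b θ)
        ((openBox.{u} _ i ε).toFunctor.map (face b θ).op (boxFace a.succ η ha')) rfl
      have h2 := boxFace_map s hb' (face a η)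
        ((openBox.{u} _ i ε).toFunctor.map (face b θ).op (boxFace a.succ η ha'))
        (face_comm hba' η θ)
      exact congrArg Subtype.val (h1.symm.trans h2))
  have hloop : P.IsLoop t := fun η => by
    rw [ht 0 η (fun h => Fin.succ_ne_zero i (congrArg Prod.fst h).symm), c_zero]
  refine exists_extension s ⟨t, hloop⟩ fun j η h => Subtype.ext ?_
  refine (loop_act_val (P := P) ⟨t, hloop⟩ (face j η)).trans ?_
  rw [face_shift]
  refine Eq.trans (ht j.succ η fun h' => h ?_) (c_succ j η h)
  simpa using h'

end LoopKan


section LowBoxes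

variable {X : CSet.{u}}

theorem act_faces {n : ℕ} (t : X.Cubes (n + 2)) {a b : Fin (n + 1)} (h : b ≤ a) (η θ : Bool) :
    X.act (X.act t (face a.succ η)) (face b θ) = X.act (X.act t (face b.castSucc θ)) (face a η) := by
  rw [← act_comp, ← act_comp, face_comm h]

theorem CSet.IsKan.fill_two (hX : X.IsKan) (i : Fin 2) (ε : Bool) (p q : Bool → X.Cubes 1)
    (h : ∀ η θ, ((1 : Fin 2), η) ≠ (i, ε) → ((0 : Fin 2), θ) ≠ (i, ε) →
      X.act (q η) (face 0 θ) = X.act (p θ) (face 0 η)) :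
    ∃ t : X.Cubes 2, (∀ η, ((0 : Fin 2), η) ≠ (i, ε) → X.act t (face 0 η) = p η) ∧
      (∀ η, ((1 : Fin 2), η) ≠ (i, ε) → X.act t (face 1 η) = q η) := by
  obtain ⟨t, ht⟩ := hX.fill i ε ![p, q] (by
    intro a b η θ _
    match a, b with
    | 0, 0 => exact h η θ)
  exact ⟨t, ht 0, ht 1⟩

theorem CSet.IsKan.fill_three (hX : X.IsKan) (i : Fin 3) (ε : Bool) (p q r : Bool → X.Cubes 2)
    (h₁ : ∀ η θ, ((1 : Fin 3), η) ≠ (i, ε) → ((0 : Fin 3), θ) ≠ (i, ε) →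
      X.act (q η) (face 0 θ) = X.act (p θ) (face 0 η))
    (h₂ : ∀ η θ, ((2 : Fin 3), η) ≠ (i, ε) → ((0 : Fin 3), θ) ≠ (i, ε) →
      X.act (r η) (face 0 θ) = X.act (p θ) (face 1 η))
    (h₃ : ∀ η θ, ((2 : Fin 3), η) ≠ (i, ε) → ((1 : Fin 3), θ) ≠ (i, ε) →
      X.act (r η) (face 1 θ) = X.act (q θ) (face 1 η)) :
    ∃ t : X.Cubes 3, (∀ η, ((0 : Fin 3), η) ≠ (i, ε) → X.act t (face 0 η) = p η) ∧
      (∀ η, ((1 : Fin 3), η) ≠ (i, ε) → X.act t (face 1 η) = q η) ∧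
      (∀ η, ((2 : Fin 3), η) ≠ (i, ε) → X.act t (face 2 η) = r η) := by
  obtain ⟨t, ht⟩ := hX.fill i ε ![p, q, r] (by
    intro a b η θ
    match a, b with
    | 0, 0 => exact fun _ => h₁ η θ
    | 0, 1 => exact fun h => absurd h (by decide)
    | 1, 0 => exact fun _ => h₂ η θ
    | 1, 1 => exact fun _ => h₃ η θ)
  exact ⟨t, ht 0, ht 1, ht 2⟩

theorem joined_refl (a : X.Cubes 0) : X.Joined a a :=
  ⟨X.act a (degen 0), by rw [← act_comp, face_degen, act_id], by
    rw [← act_comp, face_degen, act_id]⟩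

end LowBoxes

/-! ### The group structure -/

/-- The square `S` exhibits `h` as a concatenation of the loops `f` and `g`: its faces are
`f` (first direction, start), the degenerate edge (first direction, end), `g` (second direction,
end) and `h` (second direction, start). -/
def IsConcat (P : PtdCSet.{u}) (f g h : (loop P).X.Cubes 0) : Prop :=
  ∃ S : P.X.Cubes 2, P.X.act S (face 0 false) = f.1 ∧ P.X.act S (face 0 true) = P.base 1 ∧
    P.X.act S (face 1 true) = g.1 ∧ P.X.act S (face 1 false) = h.1

section Concat

variable {P : PtdCSet.{u}}

theorem joined_loop_iff {f g : (loop P).X.Cubes 0} : (loop P).X.Joined f g ↔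
    ∃ H : P.X.Cubes 2, (∀ ε, P.X.act H (face 0 ε) = P.base 1) ∧
      P.X.act H (face 1 false) = f.1 ∧ P.X.act H (face 1 true) = g.1 := by
  have key : ∀ ε, shiftHom (face (n := 0) 0 ε) = face 1 ε := fun ε => face_shift 0 ε
  constructor
  · rintro ⟨e, rfl, rfl⟩
    exact ⟨e.1, e.2, by rw [← key]; rfl, by rw [← key]; rfl⟩
  · rintro ⟨H, h0, h1, h2⟩
    rw [← key] at h1 h2
    exact ⟨⟨H, h0⟩, Subtype.ext h1, Subtype.ext h2⟩

theorem exists_isConcat (hP : P.X.IsKan) (f g : (loop P).X.Cubes 0) : ∃ h, IsConcat P f g h := by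
  obtain ⟨t, ht0, ht1⟩ := hP.fill_two 1 false (fun η => cond η (P.base 1) f.1) (fun _ => g.1) (by
    rintro (_ | _) (_ | _) h h'
    · exact absurd rfl h
    · exact absurd rfl h
    · exact (g.2 false).trans (f.2 true).symm
    · exact (g.2 true).trans (base_act P _).symm)
  have hl : P.IsLoop (P.X.act t (face 1 false)) := by
    intro θ
    have := act_faces t (le_refl (0 : Fin 1)) false θ
    refine this.trans ((congrArg (fun c => P.X.act c _) (ht0 θ (by simp))).trans ?_)
    cases θ
    · exact f.2 false
    · exact base_act P _
  exact ⟨⟨_, hl⟩, t, ht0 false (by simp), ht0 true (by simp), ht1 true (by simp), rfl⟩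

theorem isConcat_joined (hP : P.X.IsKan) {f f' g g' h h' : (loop P).X.Cubes 0}
    (H : IsConcat P f g h) (H' : IsConcat P f' g' h') (hf : (loop P).X.Joined f f')
    (hg : (loop P).X.Joined g g') : (loop P).X.Joined h h' := by
  obtain ⟨S, s1, s2, s3, s4⟩ := H
  obtain ⟨S', s1', s2', s3', s4'⟩ := H'
  obtain ⟨F, F0, F1, F2⟩ := joined_loop_iff.1 hf
  obtain ⟨G, G0, G1, G2⟩ := joined_loop_iff.1 hg
  obtain ⟨t, t0, t1, t2⟩ := hP.fill_three 1 false (fun η => cond η (P.base 2) F) (fun _ => G)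
    (fun η => cond η S' S)
    (by
      rintro η (_ | _) _ _
      · exact (G0 false).trans (F0 η).symm
      · exact (G0 true).trans (base_act P _).symm)
    (by
      rintro (_ | _) (_ | _) _ _
      · exact s1.trans F1.symm
      · exact s2.trans (base_act P _).symm
      · exact s1'.trans F2.symm
      · exact s2'.trans (base_act P _).symm)
    (by
      rintro (_ | _) (_ | _) _ h
      · exact absurd rfl h
      · exact s3.trans G1.symm
      · exact absurd rfl h
      · exact s3'.trans G2.symm)
  refine joined_loop_iff.2 ⟨P.X.act t (face 1 false), fun θ => ?_, ?_, ?_⟩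
  · refine (act_faces t (le_refl (0 : Fin 2)) false θ).trans
      ((congrArg (fun c => P.X.act c _) (t0 θ (by simp))).trans ?_)
    cases θ
    · exact F0 false
    · exact base_act P _
  · exact (act_faces t (le_refl (1 : Fin 2)) false false).symm.trans
      ((congrArg (fun c => P.X.act c _) (t2 false (by simp))).trans s4)
  · exact (act_faces t (le_refl (1 : Fin 2)) true false).symm.trans
      ((congrArg (fun c => P.X.act c _) (t2 true (by simp))).trans s4')

theorem isConcat_one (f : (loop P).X.Cubes 0) : IsConcat P (loop P).pt f f := by
  obtain ⟨H, h0, h1, h2⟩ := joined_loop_iff.1 (joined_refl f)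
  exact ⟨H, h0 false, h0 true, h2, h1⟩

theorem isConcat_assoc (hP : P.X.IsKan) {f g h fg gh k : (loop P).X.Cubes 0}
    (h₁ : IsConcat P f g fg) (h₂ : IsConcat P g h gh) (h₃ : IsConcat P f gh k) :
    IsConcat P fg h k := by
  obtain ⟨S, s1, s2, s3, s4⟩ := h₁
  obtain ⟨T, t1, t2, t3, t4⟩ := h₂
  obtain ⟨U, u1, u2, u3, u4⟩ := h₃
  obtain ⟨R, r1, r2, r3, r4⟩ := isConcat_one h
  obtain ⟨w, w0, w1, w2⟩ := hP.fill_three 2 false (fun η => cond η (P.base 2) S)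
    (fun η => cond η R U) (fun _ => T)
    (by
      rintro (_ | _) (_ | _) _ _
      · exact u1.trans s1.symm
      · exact u2.trans (base_act P _).symm
      · exact r1.trans s2.symm
      · exact r2.trans (base_act P _).symm)
    (by
      rintro (_ | _) (_ | _) h _
      · exact absurd rfl h
      · exact absurd rfl h
      · exact t1.trans s3.symm
      · exact t2.trans (base_act P _).symm)
    (by
      rintro (_ | _) (_ | _) h _
      · exact absurd rfl h
      · exact absurd rfl h
      · exact t4.trans u3.symm
      · exact t3.trans r3.symm)
  refine ⟨P.X.act w (face 2 false), ?_, ?_, ?_, ?_⟩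
  · exact (act_faces w (Fin.zero_le (1 : Fin 2)) false false).trans
      ((congrArg (fun c => P.X.act c _) (w0 false (by simp))).trans s4)
  · exact (act_faces w (Fin.zero_le (1 : Fin 2)) false true).trans
      ((congrArg (fun c => P.X.act c _) (w0 true (by simp))).trans (base_act P _))
  · exact (act_faces w (le_refl (1 : Fin 2)) false true).trans
      ((congrArg (fun c => P.X.act c _) (w1 true (by simp))).trans r4)
  · exact (act_faces w (le_refl (1 : Fin 2)) false false).trans
      ((congrArg (fun c => P.X.act c _) (w1 false (by simp))).trans u4)

theorem exists_left_inverse (hP : P.X.IsKan) (f : (loop P).X.Cubes 0) :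
    ∃ g, IsConcat P g f (loop P).pt := by
  obtain ⟨t, t0, t1⟩ := hP.fill_two 0 false (fun _ => P.base 1) (fun η => cond η f.1 (P.base 1)) (by
    rintro (_ | _) (_ | _) h h'
    · exact absurd rfl h'
    · exact (base_act P _).trans (base_act P _).symm
    · exact absurd rfl h'
    · exact (f.2 true).trans (base_act P _).symm)
  have hl : P.IsLoop (P.X.act t (face 0 false)) := by
    intro η
    refine (act_faces t (le_refl (0 : Fin 1)) η false).symm.trans
      ((congrArg (fun c => P.X.act c _) (t1 η (by simp))).trans ?_)
    cases η
    · exact base_act P _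
    · exact f.2 false
  exact ⟨⟨_, hl⟩, t, rfl, t0 true (by simp), t1 true (by simp), t1 false (by simp)⟩

end Concat

/-- Pointed Kan complexes. -/
class PtdCSet.Kan (P : PtdCSet.{u}) : Prop where
  isKan : P.X.IsKan

instance (P : PtdCSet.{u}) [P.Kan] : (loop P).Kan := ⟨loop_isKan PtdCSet.Kan.isKan⟩

instance (P : PtdCSet.{u}) [P.Kan] (n : ℕ) : (iterLoop P n).Kan := by
  induction n with
  | zero => assumption
  | succ n ih => exact inferInstanceAs (loop (iterLoop P n)).Kan

/-- The fundamental group of a pointed cubical set, as a set: the connected components of the loop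
space. -/
def FundamentalGroup (P : PtdCSet.{u}) : Type u := (loop P).X.Pi0

/-- The class of a loop. -/
def FundamentalGroup.mk {P : PtdCSet.{u}} (f : (loop P).X.Cubes 0) : FundamentalGroup P :=
  Quot.mk _ f

namespace FundamentalGroup

variable {P : PtdCSet.{u}} [P.Kan]

/-- A choice of a concatenation of two loops. -/
noncomputable def concat (f g : (loop P).X.Cubes 0) : (loop P).X.Cubes 0 :=
  (exists_isConcat (PtdCSet.Kan.isKan (P := P)) f g).choose

theorem isConcat_concat (f g : (loop P).X.Cubes 0) : IsConcat P f g (concat f g) :=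
  (exists_isConcat (PtdCSet.Kan.isKan (P := P)) f g).choose_spec

/-- The product of two classes is the class of any concatenation of representatives, see
`mk_mul_mk`. -/
noncomputable instance : Mul (FundamentalGroup P) where
  mul := Quot.map₂ concat
    (fun f _ _ hg => isConcat_joined PtdCSet.Kan.isKan (isConcat_concat f _) (isConcat_concat f _)
      (joined_refl f) hg)
    (fun _ _ g hf => isConcat_joined PtdCSet.Kan.isKan (isConcat_concat _ g) (isConcat_concat _ g)
      hf (joined_refl g))

theorem mk_mul_mk {f g h : (loop P).X.Cubes 0} (H : IsConcat P f g h) :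
    FundamentalGroup.mk f * FundamentalGroup.mk g = FundamentalGroup.mk h :=
  Quot.sound (isConcat_joined PtdCSet.Kan.isKan (isConcat_concat f g) H (joined_refl f)
    (joined_refl g))

instance : One (FundamentalGroup P) := ⟨FundamentalGroup.mk (loop P).pt⟩

theorem exists_inv (a : FundamentalGroup P) : ∃ b : FundamentalGroup P, b * a = 1 := by
  obtain ⟨f, rfl⟩ := Quot.exists_rep a
  obtain ⟨g, hg⟩ := exists_left_inverse (PtdCSet.Kan.isKan (P := P)) f
  exact ⟨FundamentalGroup.mk g, mk_mul_mk hg⟩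

noncomputable instance : Inv (FundamentalGroup P) := ⟨fun a => (exists_inv a).choose⟩

/-- The group structure on the fundamental group of a pointed Kan complex. -/
noncomputable instance : Group (FundamentalGroup P) :=
  Group.ofLeftAxioms
    (by
      intro a b c
      obtain ⟨f, rfl⟩ := Quot.exists_rep a
      obtain ⟨g, rfl⟩ := Quot.exists_rep b
      obtain ⟨h, rfl⟩ := Quot.exists_rep c
      obtain ⟨fg, h₁⟩ := exists_isConcat (PtdCSet.Kan.isKan (P := P)) f g
      obtain ⟨gh, h₂⟩ := exists_isConcat (PtdCSet.Kan.isKan (P := P)) g h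
      obtain ⟨k, h₃⟩ := exists_isConcat (PtdCSet.Kan.isKan (P := P)) f gh
      change FundamentalGroup.mk f * FundamentalGroup.mk g * FundamentalGroup.mk h =
        FundamentalGroup.mk f * (FundamentalGroup.mk g * FundamentalGroup.mk h)
      rw [mk_mul_mk h₁, mk_mul_mk h₂, mk_mul_mk h₃,
        mk_mul_mk (isConcat_assoc PtdCSet.Kan.isKan h₁ h₂ h₃)])
    (by
      intro a
      obtain ⟨f, rfl⟩ := Quot.exists_rep a
      exact mk_mul_mk (isConcat_one f))
    (fun a => (exists_inv a).choose_spec)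

end FundamentalGroup

/-- The `n`-th homotopy group `πₙ(X, x)`, as a set: the connected components of the `n`-th loop
space. -/
def HomotopyGroup (n : ℕ) (P : PtdCSet.{u}) : Type u := (iterLoop P n).X.Pi0

/-- For `n ≥ 1`, the `n`-th homotopy group is the fundamental group of the `(n-1)`-st loop space, and
carries the group structure of the latter. -/
noncomputable instance (n : ℕ) (P : PtdCSet.{u}) [P.Kan] : Group (HomotopyGroup (n + 1) P) :=
  inferInstanceAs (Group (FundamentalGroup (iterLoop P n)))


/-! ### Comparison with the colimit -/

/-- All vertices of a cube lie in one connected component. -/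
theorem vertex_eq {X : CSet.{u}} : ∀ {n : ℕ} (c : X.Cubes n) (v w : (⟨0⟩ : Box) ⟶ ⟨n⟩),
    (Quot.mk _ (X.act c v) : X.Pi0) = Quot.mk _ (X.act c w)
  | 0, c, v, w => by rw [toPoint_unique v w]
  | n + 1, c, v, w => by
    have key : ∀ v : (⟨0⟩ : Box) ⟶ ⟨n + 1⟩, (Quot.mk _ (X.act c v) : X.Pi0) =
        Quot.mk _ (X.act (X.act c (face 0 false)) (v ≫ degen 0)) := by
      intro v
      have hsq : ∀ ε, X.act (X.act c (shiftHom (v ≫ degen 0))) (face 0 ε) =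
          X.act (X.act c (face 0 ε)) (v ≫ degen 0) := fun ε => by
        rw [← act_comp, face_zero_shift, act_comp]
      have hv : v = (v ≫ degen 0) ≫ face 0 (v.1 (fun j => j.elim0) 0) :=
        (degen_face v 0 _ fun x => by rw [Subsingleton.elim x]).symm
      have hedge : (Quot.mk _ (X.act (X.act c (face 0 false)) (v ≫ degen 0)) : X.Pi0) =
          Quot.mk _ (X.act (X.act c (face 0 true)) (v ≫ degen 0)) :=
        Quot.sound ⟨_, hsq false, hsq true⟩
      rcases h : v.1 (fun j => j.elim0) 0 with _ | _
      · rw [h] at hv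
        conv_lhs => rw [hv, act_comp]
      · rw [h] at hv
        conv_lhs => rw [hv, act_comp]
        exact hedge.symm
    rw [key v, key w]
    exact vertex_eq _ _ _

/-- The set of connected components is the colimit of `X`, regarded as a diagram of sets. -/
theorem pi0_bijective (X : CSet.{u}) : Function.Bijective
    (Quot.lift (fun a => X.ιColimitType (op ⟨0⟩) a) (by
      rintro _ _ ⟨e, rfl, rfl⟩
      exact (X.ιColimitType_map (face 0 false).op e).trans
        (X.ιColimitType_map (face 0 true).op e).symm) : X.Pi0 → X.ColimitType) := by
  let vtx : ∀ n : ℕ, (⟨0⟩ : Box) ⟶ ⟨n⟩ := fun n => Nat.rec (𝟙 _) (fun _ f => f ≫ face 0 false) n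
  let back : X.ColimitType → X.Pi0 := Quot.lift
    (fun p => Quot.mk _ (X.act (n := p.1.unop.dim) p.2 (vtx p.1.unop.dim))) (by
      rintro ⟨⟨⟨m⟩⟩, c⟩ ⟨⟨⟨n⟩⟩, d⟩ h
      obtain ⟨f, hf⟩ : ∃ f : (op (⟨m⟩ : Box)) ⟶ op ⟨n⟩, d = X.map f c := h
      subst hf
      exact (vertex_eq c (vtx m) (vtx n ≫ f.unop)).trans
        (congrArg (Quot.mk _) (act_comp (X := X) (vtx n) f.unop c)))
  refine Function.bijective_iff_has_inverse.2 ⟨back, ?_, ?_⟩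
  · rintro ⟨a⟩
    exact congrArg (Quot.mk _) (act_id a)
  · rintro ⟨⟨⟨⟨n⟩⟩, c⟩⟩
    exact X.ιColimitType_map (vtx n).op c

end Cubical

namespace Cubical

/-! This is the Eckmann–Hilton argument, carried out on cubes rather than on homotopy classes. An
element of the second homotopy group is represented by a square of `X` whose four faces are all
degenerate at the base point (`isSphere_loop_loop`), and such squares can be concatenated in either
of their two directions. Each concatenation is a relation "`h` is a composite of `f` and `g`",
witnessed by a 3-cube. The group law comes from the second direction (`isConcat_loop_iff`).

Two facts carry the proof. First, the base square is a strict two-sided unit for both relations: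
degeneracies give the left unit 3-cubes and max-connections the right ones. Second, the relations
interchange: in a 2×2 array of squares with given row and column composites, a composite of the rows
is also a composite of the columns, and conversely. The witnesses of all these composites are faces
of one 4-cube, so either direction of the interchange is a single open box filling.

Applying interchange to the arrays `(f 1; 1 g)` and `(1 g; f 1)`, with `1` the base square, turns a
composite `h` of `f, g` in the second direction into one in the first direction, and then into a
composite of `g, f` in the second direction. The square `h` never changes, so no further homotopy is
needed. Higher groups reduce to this case by replacing `X` with an iterated loop space. -/

/-- The connection `[1]^(n+1) ⟶ [1]^n` as a morphism of the cube category. -/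
def conn {n : ℕ} (i : Fin n) (ε : Bool) : (⟨n + 1⟩ : Box) ⟶ ⟨n⟩ :=
  ⟨connMap i ε, IsBoxMap.conn i ε⟩

/-! ### Cubical identities between `[1]^2` and `[1]^3`. -/

section LowDimensionalIdentities

theorem face_degen_one_zero (ε : Bool) :
    face 0 ε ≫ degen (n := 2) 1 = degen 0 ≫ face 0 ε :=
  -- A morphism is determined by its values on the finitely many vertices of `[1]^2`, so the
  -- identity is a finite check.
  Box.hom_ext (by revert ε; decide)

theorem face_degen_one_two (ε : Bool) :
    face 2 ε ≫ degen (n := 2) 1 = degen 1 ≫ face 1 ε :=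
  Box.hom_ext (by revert ε; decide)

theorem face_degen_two (i : Fin 2) (ε : Bool) :
    face i.castSucc ε ≫ degen (n := 2) 2 = degen 1 ≫ face i ε :=
  Box.hom_ext (by revert i ε; decide)

theorem face_castSucc_conn (i : Fin 2) (ε : Bool) : face i.castSucc ε ≫ conn i ε = 𝟙 _ :=
  Box.hom_ext (by revert i ε; decide)

theorem face_succ_conn (i : Fin 2) (ε : Bool) : face i.succ ε ≫ conn i ε = 𝟙 _ :=
  Box.hom_ext (by revert i ε; decide)

theorem face_castSucc_not_conn (i : Fin 2) (ε : Bool) :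
    face i.castSucc (!ε) ≫ conn i ε = degen i ≫ face i (!ε) :=
  Box.hom_ext (by revert i ε; decide)

theorem face_succ_not_conn (i : Fin 2) (ε : Bool) :
    face i.succ (!ε) ≫ conn i ε = degen i ≫ face i (!ε) :=
  Box.hom_ext (by revert i ε; decide)

theorem face_two_conn_zero (ε η : Bool) :
    face 2 η ≫ conn (n := 2) 0 ε = conn 0 ε ≫ face 1 η :=
  Box.hom_ext (by revert ε η; decide)

theorem face_zero_conn_one (ε η : Bool) :
    face 0 η ≫ conn (n := 2) 1 ε = conn 0 ε ≫ face 0 η :=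
  Box.hom_ext (by revert ε η; decide)

end LowDimensionalIdentities

/-- Opposite faces of a cube are disjoint, so compatibility has to be required only once for each of
the six pairs of distinct directions. This form of `fill` presents the prescribed faces direction by
direction. -/
theorem CSet.IsKan.fill_four {X : CSet.{u}} (hX : X.IsKan) (i : Fin 4) (ε : Bool)
    (p q r s : Bool → X.Cubes 3)
    (h₁ : ∀ η θ, ((1 : Fin 4), η) ≠ (i, ε) → ((0 : Fin 4), θ) ≠ (i, ε) →
      X.act (q η) (face 0 θ) = X.act (p θ) (face 0 η))
    (h₂ : ∀ η θ, ((2 : Fin 4), η) ≠ (i, ε) → ((0 : Fin 4), θ) ≠ (i, ε) →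
      X.act (r η) (face 0 θ) = X.act (p θ) (face 1 η))
    (h₃ : ∀ η θ, ((2 : Fin 4), η) ≠ (i, ε) → ((1 : Fin 4), θ) ≠ (i, ε) →
      X.act (r η) (face 1 θ) = X.act (q θ) (face 1 η))
    (h₄ : ∀ η θ, ((3 : Fin 4), η) ≠ (i, ε) → ((0 : Fin 4), θ) ≠ (i, ε) →
      X.act (s η) (face 0 θ) = X.act (p θ) (face 2 η))
    (h₅ : ∀ η θ, ((3 : Fin 4), η) ≠ (i, ε) → ((1 : Fin 4), θ) ≠ (i, ε) →
      X.act (s η) (face 1 θ) = X.act (q θ) (face 2 η))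
    (h₆ : ∀ η θ, ((3 : Fin 4), η) ≠ (i, ε) → ((2 : Fin 4), θ) ≠ (i, ε) →
      X.act (s η) (face 2 θ) = X.act (r θ) (face 2 η)) :
    ∃ t : X.Cubes 4, (∀ η, ((0 : Fin 4), η) ≠ (i, ε) → X.act t (face 0 η) = p η) ∧
      (∀ η, ((1 : Fin 4), η) ≠ (i, ε) → X.act t (face 1 η) = q η) ∧
      (∀ η, ((2 : Fin 4), η) ≠ (i, ε) → X.act t (face 2 η) = r η) ∧
      (∀ η, ((3 : Fin 4), η) ≠ (i, ε) → X.act t (face 3 η) = s η) := by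
  obtain ⟨t, ht⟩ := hX.fill i ε ![p, q, r, s] (by
    intro a b η θ
    -- The pair `(a, b)` stands for the directions `a + 1` and `b`; those with `b > a` are excluded
    -- by the hypothesis `b ≤ a` of `fill`.
    match a, b with
    | 0, 0 => exact fun _ => h₁ η θ
    | 0, 1 => exact fun h => absurd h (by decide)
    | 0, 2 => exact fun h => absurd h (by decide)
    | 1, 0 => exact fun _ => h₂ η θ
    | 1, 1 => exact fun _ => h₃ η θ
    | 1, 2 => exact fun h => absurd h (by decide)
    | 2, 0 => exact fun _ => h₄ η θ
    | 2, 1 => exact fun _ => h₅ η θ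
    | 2, 2 => exact fun _ => h₆ η θ)
  exact ⟨t, ht 0, ht 1, ht 2, ht 3⟩

/-! ### Concatenation of squares in two directions, and its units. -/

section EckmannHilton

variable {P : PtdCSet.{u}}

/-- All faces of the square `f` are degenerate at the base point. -/
def PtdCSet.IsSphere (P : PtdCSet.{u}) (f : P.X.Cubes 2) : Prop :=
  ∀ i ε, P.X.act f (face i ε) = P.base 1

/-- The `3`-cube `T` exhibits `h` as a concatenation of `f` and `g` in the first direction. -/
def IsFirstConcat (P : PtdCSet.{u}) (f g h : P.X.Cubes 2) : Prop :=
  ∃ T : P.X.Cubes 3, P.X.act T (face 0 false) = f ∧ P.X.act T (face 0 true) = P.base 2 ∧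
    P.X.act T (face 1 false) = h ∧ P.X.act T (face 1 true) = g ∧
    ∀ ε, P.X.act T (face 2 ε) = P.base 2

/-- The `3`-cube `T` exhibits `h` as a concatenation of `f` and `g` in the second direction. -/
def IsSecondConcat (P : PtdCSet.{u}) (f g h : P.X.Cubes 2) : Prop :=
  ∃ T : P.X.Cubes 3, (∀ ε, P.X.act T (face 0 ε) = P.base 2) ∧
    P.X.act T (face 1 false) = f ∧ P.X.act T (face 1 true) = P.base 2 ∧
    P.X.act T (face 2 false) = h ∧ P.X.act T (face 2 true) = g

/-- Used with `k` a face followed by a degeneracy or a connection: the cubical identities factor `k`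
through a face of `[1]^2`, which gives the base faces of the unit cubes below. -/
theorem PtdCSet.IsSphere.act_comp_face {f : P.X.Cubes 2} (hf : P.IsSphere f) {m : ℕ}
    {k : (⟨m⟩ : Box) ⟶ ⟨2⟩} {g : (⟨m⟩ : Box) ⟶ ⟨1⟩} {i : Fin 2} {ε : Bool}
    (h : k = g ≫ face i ε) : P.X.act f k = P.base m := by
  rw [h, act_comp, hf, base_act]

theorem isFirstConcat_base_left {f : P.X.Cubes 2} (hf : P.IsSphere f) :
    IsFirstConcat P (P.base 2) f f := by
  -- The cube is constant in direction 1, so both its faces there are `f`; the remaining faces come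
  -- from faces of `f`.
  refine ⟨P.X.act f (degen 1), ?_, ?_, ?_, ?_, fun ε => ?_⟩ <;> rw [← act_comp]
  · exact hf.act_comp_face (face_degen_one_zero _)
  · exact hf.act_comp_face (face_degen_one_zero _)
  · rw [face_degen, act_id]
  · rw [face_degen, act_id]
  · exact hf.act_comp_face (face_degen_one_two _)

/-- A degeneracy puts `f` on opposite faces, whereas a right unit needs it on the adjacent faces
`(0, 0)` and `(1, 0)`. The max-connection does this, and collapses the two faces opposite to them to
the base point. -/
theorem isFirstConcat_base_right {f : P.X.Cubes 2} (hf : P.IsSphere f) :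
    IsFirstConcat P f (P.base 2) f := by
  refine ⟨P.X.act f (conn 0 false), ?_, ?_, ?_, ?_, fun ε => ?_⟩ <;> rw [← act_comp]
  · exact (congrArg _ (face_castSucc_conn 0 false)).trans (act_id f)
  · exact hf.act_comp_face (face_castSucc_not_conn 0 false)
  · exact (congrArg _ (face_succ_conn 0 false)).trans (act_id f)
  · exact hf.act_comp_face (face_succ_not_conn 0 false)
  · exact hf.act_comp_face (face_two_conn_zero false ε)

theorem isSecondConcat_base_left {f : P.X.Cubes 2} (hf : P.IsSphere f) :
    IsSecondConcat P (P.base 2) f f := by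
  refine ⟨P.X.act f (degen 2), fun ε => ?_, ?_, ?_, ?_, ?_⟩ <;> rw [← act_comp]
  · exact hf.act_comp_face (face_degen_two 0 ε)
  · exact hf.act_comp_face (face_degen_two 1 _)
  · exact hf.act_comp_face (face_degen_two 1 _)
  · rw [face_degen, act_id]
  · rw [face_degen, act_id]

theorem isSecondConcat_base_right {f : P.X.Cubes 2} (hf : P.IsSphere f) :
    IsSecondConcat P f (P.base 2) f := by
  refine ⟨P.X.act f (conn 1 false), fun ε => ?_, ?_, ?_, ?_, ?_⟩ <;> rw [← act_comp]
  · exact hf.act_comp_face (face_zero_conn_one false ε)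
  · exact (congrArg _ (face_castSucc_conn 1 false)).trans (act_id f)
  · exact hf.act_comp_face (face_castSucc_not_conn 1 false)
  · exact (congrArg _ (face_succ_conn 1 false)).trans (act_id f)
  · exact hf.act_comp_face (face_succ_not_conn 1 false)

/-! ### Interchange by filling open boxes in the 4-cube. -/

/-- The interchange law, for a composite computed in the second direction last. -/
theorem IsSecondConcat.interchange (hP : P.X.IsKan) {a b c d ab cd ac bd k : P.X.Cubes 2}
    (hab : IsFirstConcat P a b ab) (hcd : IsFirstConcat P c d cd)
    (hac : IsSecondConcat P a c ac) (hbd : IsSecondConcat P b d bd)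
    (hk : IsSecondConcat P ab cd k) : IsFirstConcat P ac bd k := by
  obtain ⟨A, a1, a2, a3, a4, a5⟩ := hab
  obtain ⟨C, c1, c2, c3, c4, c5⟩ := hcd
  obtain ⟨L, l1, l2, l3, l4, l5⟩ := hac
  obtain ⟨R, r1, r2, r3, r4, r5⟩ := hbd
  obtain ⟨K, k1, k2, k3, k4, k5⟩ := hk
  -- In the 4-cube, directions 0 and 1 carry concatenation in the first direction, and 2 and 3 carry
  -- it in the second. The faces `(0,0)`, `(1,1)`, `(1,0)` are the witnesses for the columns and for
  -- `k`; `(2,0)` and `(3,1)` are those for the rows; `(0,1)` and `(2,1)` are base. The missing face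
  -- `(3,0)` is the desired witness.
  obtain ⟨t, t0, t1, t2, -⟩ := hP.fill_four 3 false (fun η => cond η (P.base 3) L)
    (fun η => cond η R K) (fun η => cond η (P.base 3) A) (fun _ => C)
    (by rintro (_ | _) (_ | _) - - <;> simp [*, base_act])
    (by rintro (_ | _) (_ | _) - - <;> simp [*, base_act])
    (by rintro (_ | _) (_ | _) - - <;> simp [*, base_act])
    (by rintro (_ | _) (_ | _) h - <;> first | exact absurd rfl h | simp [*, base_act])
    (by rintro (_ | _) (_ | _) h - <;> first | exact absurd rfl h | simp [*])
    (by rintro (_ | _) (_ | _) h - <;> first | exact absurd rfl h | simp [*, base_act])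
  have e0 := fun η => act_faces t (Fin.zero_le (2 : Fin 3)) false η
  have e1 := fun η => act_faces t (show (1 : Fin 3) ≤ 2 by decide) false η
  have e2 := fun η => act_faces t (le_refl (2 : Fin 3)) false η
  refine ⟨P.X.act t (face 3 false), ?_, ?_, ?_, ?_, fun η => ?_⟩
  · exact (e0 false).trans ((congrArg (fun c => P.X.act c _) (t0 false (by simp))).trans l4)
  · exact (e0 true).trans
      ((congrArg (fun c => P.X.act c _) (t0 true (by simp))).trans (base_act P _))
  · exact (e1 false).trans ((congrArg (fun c => P.X.act c _) (t1 false (by simp))).trans k4)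
  · exact (e1 true).trans ((congrArg (fun c => P.X.act c _) (t1 true (by simp))).trans r4)
  · refine (e2 η).trans ((congrArg (fun c => P.X.act c _) (t2 η (by simp))).trans ?_)
    cases η
    · exact a5 false
    · exact base_act P _

/-- The interchange law, for a composite computed in the first direction last. -/
theorem IsFirstConcat.interchange (hP : P.X.IsKan) {a b c d ab cd ac bd k : P.X.Cubes 2}
    (hab : IsFirstConcat P a b ab) (hcd : IsFirstConcat P c d cd)
    (hac : IsSecondConcat P a c ac) (hbd : IsSecondConcat P b d bd)
    (hk : IsFirstConcat P ac bd k) : IsSecondConcat P ab cd k := by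
  obtain ⟨A, a1, a2, a3, a4, a5⟩ := hab
  obtain ⟨C, c1, c2, c3, c4, c5⟩ := hcd
  obtain ⟨L, l1, l2, l3, l4, l5⟩ := hac
  obtain ⟨R, r1, r2, r3, r4, r5⟩ := hbd
  obtain ⟨K, k1, k2, k3, k4, k5⟩ := hk
  -- The same 4-cube as in the other interchange law, now with `(3,0)` given by `K` and the face
  -- `(1,0)` missing.
  obtain ⟨t, t0, -, t2, t3⟩ := hP.fill_four 1 false (fun η => cond η (P.base 3) L)
    (fun _ => R) (fun η => cond η (P.base 3) A) (fun η => cond η C K)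
    (by rintro (_ | _) (_ | _) h - <;> first | exact absurd rfl h | simp [*, base_act])
    (by rintro (_ | _) (_ | _) - - <;> simp [*, base_act])
    (by rintro (_ | _) (_ | _) - h <;> first | exact absurd rfl h | simp [*, base_act])
    (by rintro (_ | _) (_ | _) - - <;> simp [*, base_act])
    (by rintro (_ | _) (_ | _) - h <;> first | exact absurd rfl h | simp [*])
    (by rintro (_ | _) (_ | _) - - <;> simp [*, base_act])
  have e0 := fun η => act_faces t (Fin.zero_le (0 : Fin 3)) false η
  have e2 := fun η => (act_faces t (show (1 : Fin 3) ≤ 1 by decide) η false).symm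
  have e3 := fun η => (act_faces t (show (1 : Fin 3) ≤ 2 by decide) η false).symm
  refine ⟨P.X.act t (face 1 false), fun η => ?_, ?_, ?_, ?_, ?_⟩
  · refine (e0 η).trans ((congrArg (fun c => P.X.act c _) (t0 η (by simp))).trans ?_)
    cases η
    · exact l1 false
    · exact base_act P _
  · exact (e2 false).trans ((congrArg (fun c => P.X.act c _) (t2 false (by simp))).trans a3)
  · exact (e2 true).trans
      ((congrArg (fun c => P.X.act c _) (t2 true (by simp))).trans (base_act P _))
  · exact (e3 false).trans ((congrArg (fun c => P.X.act c _) (t3 false (by simp))).trans k3)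
  · exact (e3 true).trans ((congrArg (fun c => P.X.act c _) (t3 true (by simp))).trans c3)

/-- The Eckmann–Hilton argument. -/
theorem IsSecondConcat.comm (hP : P.X.IsKan) {f g h : P.X.Cubes 2} (hf : P.IsSphere f)
    (hg : P.IsSphere g) (H : IsSecondConcat P f g h) : IsSecondConcat P g f h :=
  -- The array with rows `(1, g)` and `(f, 1)`: its columns compose to `f` and `g`, its rows to `g`
  -- and `f`.
  (isFirstConcat_base_left hg).interchange hP (isFirstConcat_base_right hf)
    (isSecondConcat_base_left hf) (isSecondConcat_base_right hg)
    -- The array with rows `(f, 1)` and `(1, g)`: rows and columns both compose to `f` and `g`, so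
    -- `h` becomes a composite in the first direction.
    (IsSecondConcat.interchange hP (isFirstConcat_base_right hf) (isFirstConcat_base_left hg)
      (isSecondConcat_base_right hf) (isSecondConcat_base_left hg) H)

/-! ### Translation to iterated loop spaces. -/

theorem isSphere_loop_loop (f : (loop (loop P)).X.Cubes 0) : P.IsSphere f.1.1 := by
  intro i ε
  match i with
  | 0 => exact f.1.2 ε
  | 1 =>
    -- Direction 0 of the loop space is direction 1 of `X`, so the outer loop condition controls
    -- these faces.
    rw [show (1 : Fin 2) = Fin.succ 0 from rfl, ← face_shift]
    refine (congrArg Subtype.val (f.2 ε)).trans ?_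
    exact base_act P _

theorem loop_base_val (n : ℕ) : ((loop P).base n).1 = P.base (n + 1) := base_act P _

/-- A square of the loop space is a 3-cube of `X` with base faces in direction 0, and its direction
`i` is direction `i + 1` there. The loop condition thus becomes the first clause of
`IsSecondConcat`. -/
theorem isConcat_loop_iff {f g h : (loop (loop P)).X.Cubes 0} :
    IsConcat (loop P) f g h ↔ IsSecondConcat P f.1.1 g.1.1 h.1.1 := by
  have key : ∀ (S : (loop P).X.Cubes 2) (i : Fin 2) (ε : Bool),
      ((loop P).X.act S (face i ε)).1 = P.X.act (n := 3) S.1 (face i.succ ε) := fun S i ε => by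
    rw [loop_act_val, face_shift]
  constructor
  · rintro ⟨S, h1, h2, h3, h4⟩
    exact ⟨S.1, S.2, (key S 0 false).symm.trans (congrArg Subtype.val h1),
      (key S 0 true).symm.trans ((congrArg Subtype.val h2).trans (loop_base_val 1)),
      (key S 1 false).symm.trans (congrArg Subtype.val h4),
      (key S 1 true).symm.trans (congrArg Subtype.val h3)⟩
  · rintro ⟨T, h0, h1, h2, h3, h4⟩
    exact ⟨⟨T, h0⟩, Subtype.ext ((key ⟨T, h0⟩ 0 false).trans h1),
      Subtype.ext ((key ⟨T, h0⟩ 0 true).trans (h2.trans (loop_base_val 1).symm)),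
      Subtype.ext ((key ⟨T, h0⟩ 1 true).trans h4),
      Subtype.ext ((key ⟨T, h0⟩ 1 false).trans h3)⟩

theorem FundamentalGroup.loop_mul_comm [P.Kan] (a b : FundamentalGroup (loop P)) :
    a * b = b * a := by
  obtain ⟨f, rfl⟩ := Quot.exists_rep a
  obtain ⟨g, rfl⟩ := Quot.exists_rep b
  obtain ⟨h, H⟩ := exists_isConcat (PtdCSet.Kan.isKan (P := loop P)) f g
  -- One and the same `h` represents both products.
  have H' : IsConcat (loop P) g f h := isConcat_loop_iff.2
    ((isConcat_loop_iff.1 H).comm PtdCSet.Kan.isKan (isSphere_loop_loop f) (isSphere_loop_loop g))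
  exact (mk_mul_mk H).trans (mk_mul_mk H').symm

end EckmannHilton

end Cubical

/-- For every pointed Kan complex `P = (X, x)` and every `n ≥ 2`, written `n + 2` with `n : ℕ`, the
group `πₙ(X, x)` is abelian. -/
theorem mainTheorem8 (P : Cubical.PtdCSet.{u}) [P.Kan] (n : ℕ)
    (a b : Cubical.HomotopyGroup (n + 2) P) : a * b = b * a :=
  -- By definition `HomotopyGroup (n + 2) P` is the fundamental group of `loop (iterLoop P n)`, with
  -- the same multiplication.
  Cubical.FundamentalGroup.loop_mul_comm (P := Cubical.iterLoop P n) a b
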